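/- Let $K$ be an infinite field. Call $K$ ACVF-like if there is a henselian valuation on $K$ with algebraically closed residue field; for a prime $p$, call $K$ $p$CF-like if there is a henselian valuation on $K$ with finite residue field of characteristic $p$; and call $K$ RCVF-like if there is a henselian valuation on $K$ with real closed residue field. In all three cases the valuation is allowed to be trivial. Then $K$ satisfies at most one of the following: (1) $K$ is ACVF-like; (2) $K$ is $p$CF-like for some prime $p$; (3) $K$ is RCVF-like. In case (2) the prime $p$ is uniquely determined: if $K$ is $p$CF-like and $q$CF-like for primes $p, q$, then $p = q$. -/

import Mathlib

/-- A henselian valuation on `K`, given by its valuation ring: Hensel's lemma holds in the valuation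
ring. The trivial valuation, `A = ⊤`, is allowed. -/
def IsHenselianValuationRing {K : Type*} [Field K] (A : ValuationSubring K) : Prop :=
  HenselianLocalRing A

/-- `K` has a henselian valuation with algebraically closed residue field. -/
def IsACVFLike (K : Type*) [Field K] : Prop :=
  ∃ A : ValuationSubring K,
    IsHenselianValuationRing A ∧ IsAlgClosed (IsLocalRing.ResidueField A)

/-- `K` has a henselian valuation with finite residue field of characteristic the prime `p`. -/
def IsPCFLike (p : ℕ) (K : Type*) [Field K] : Prop :=
  p.Prime ∧ ∃ A : ValuationSubring K,
    IsHenselianValuationRing A ∧ Finite (IsLocalRing.ResidueField A) ∧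
      CharP (IsLocalRing.ResidueField A) p

/-- `K` has a henselian valuation with real closed residue field. -/
def IsRCVFLike (K : Type*) [Field K] : Prop :=
  ∃ A : ValuationSubring K,
    IsHenselianValuationRing A ∧ IsRealClosed (IsLocalRing.ResidueField A)

/-! A simple root of a monic integer polynomial in the residue field of a henselian `A` lifts to
`A`. The lift is integral over ℤ, so it lies in every valuation ring `B` of `K` and reduces to a
root in the residue field of `B`. Only `A` need be henselian. Two residue types are thus
incompatible once some monic integer polynomial has a simple root in one and no root in the other.
Against real closed fields, `X ^ 2 + X + p` (characteristic p) and `X ^ 2 + 1` (algebraically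
closed, characteristic 0) serve; against a field with q elements, `X ^ q - X - c` with c nonzero
there. -/

open Polynomial in
/-- A root in `K` of a monic integral polynomial reduces to a root in the residue field of every
valuation subring of `K`. -/
theorem ValuationSubring.exists_residue_root {K : Type*} [Field K] (B : ValuationSubring K)
    {f : ℤ[X]} (hf : f.Monic) {x : K} (hx : aeval x f = 0) :
    ∃ y : IsLocalRing.ResidueField B, aeval y f = 0 := by
  have hint : IsIntegral B x :=
    ⟨f.map (algebraMap ℤ B), hf.map _, by
      rw [← aeval_def, aeval_map_algebraMap, hx]⟩
  obtain ⟨b, rfl⟩ := IsIntegrallyClosed.isIntegral_iff.mp hint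
  refine ⟨IsLocalRing.residue B b, ?_⟩
  have hb : aeval b f = 0 := by
    rwa [aeval_algebraMap_apply, map_eq_zero_iff _ (IsFractionRing.injective B K)] at hx
  rw [← IsLocalRing.ResidueField.algebraMap_eq, aeval_algebraMap_apply, hb, map_zero]

open Polynomial in
/-- A simple root of a monic integral polynomial in the residue field of a henselian valuation
ring of `K` yields a root in the residue field of every valuation subring of `K`. -/
theorem IsHenselianValuationRing.exists_residue_root {K : Type*} [Field K]
    {A : ValuationSubring K} (hA : IsHenselianValuationRing A) (B : ValuationSubring K)
    {f : ℤ[X]} (hf : f.Monic) {t : IsLocalRing.ResidueField A} (ht : aeval t f = 0)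
    (ht' : aeval t (derivative f) ≠ 0) :
    ∃ y : IsLocalRing.ResidueField B, aeval y f = 0 := by
  have hA' := ((HenselianLocalRing.TFAE A).out 0 1 rfl rfl).mp hA
  obtain ⟨a, ha, -⟩ := hA' (f.map (algebraMap ℤ A)) (hf.map _) t (by rwa [aeval_map_algebraMap])
    (by rwa [derivative_map, aeval_map_algebraMap])
  refine B.exists_residue_root (x := algebraMap A K a) hf ?_
  rw [IsRoot, eval_map_algebraMap] at ha
  rw [aeval_algebraMap_apply, ha, map_zero]

open Polynomial in
/-- A henselian field with residue field of positive characteristic has no valuation with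
real closed residue field. -/
theorem IsHenselianValuationRing.not_isRealClosed_of_charP {K : Type*} [Field K]
    {A : ValuationSubring K} (hA : IsHenselianValuationRing A) (p : ℕ) (hp : p.Prime)
    [CharP (IsLocalRing.ResidueField A) p] (B : ValuationSubring K) :
    ¬ IsRealClosed (IsLocalRing.ResidueField B) := by
  intro hB
  -- Modulo p this is X(X + 1), with simple root 0; its discriminant 1 - 4p is negative.
  obtain ⟨y, hy⟩ := hA.exists_residue_root B (f := X ^ 2 + X + C (p : ℤ)) (by monicity!)
    (t := 0) (by simp) (by simp)
  simp only [map_add, map_pow, aeval_X, map_natCast] at hy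
  -- Chosen so that 4(y² + y + p) = 1 + ((2y + 1)² + n).
  obtain ⟨n, hn⟩ : ∃ n, 4 * p = n + 2 := ⟨4 * p - 2, by have := hp.two_le; omega⟩
  have hn' : (4 * p : IsLocalRing.ResidueField B) = n + 2 := mod_cast congrArg Nat.cast hn
  refine IsSemireal.one_add_ne_zero (R := IsLocalRing.ResidueField B)
    (s := (2 * y + 1) * (2 * y + 1) + n)
    ((IsSumSq.mul_self _).add (IsSumSq.natCast n)) ?_
  linear_combination 4 * hy - hn'

open Polynomial in
/-- A henselian field with algebraically closed residue field has no valuation with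
real closed residue field. -/
theorem IsHenselianValuationRing.not_isRealClosed_of_isAlgClosed {K : Type*} [Field K]
    {A : ValuationSubring K} (hA : IsHenselianValuationRing A)
    [IsAlgClosed (IsLocalRing.ResidueField A)] (B : ValuationSubring K) :
    ¬ IsRealClosed (IsLocalRing.ResidueField B) := by
  obtain ⟨l, hl⟩ := CharP.exists (IsLocalRing.ResidueField A)
  rcases CharP.char_is_prime_or_zero (IsLocalRing.ResidueField A) l with hlp | rfl
  -- Treated apart because `X ^ 2 + 1` is inseparable in characteristic 2.
  · exact hA.not_isRealClosed_of_charP l hlp B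
  intro hB
  have := CharP.charP_to_charZero (IsLocalRing.ResidueField A)
  obtain ⟨t, ht⟩ := IsAlgClosed.exists_pow_nat_eq (-1 : IsLocalRing.ResidueField A) two_pos
  have ht0 : t ≠ 0 := by rintro rfl; simp at ht
  obtain ⟨y, hy⟩ := hA.exists_residue_root B (f := X ^ 2 + C 1) (by monicity!)
    (t := t) (by simp [ht]) (by simp [map_ofNat, ht0])
  simp only [map_add, map_pow, aeval_X, map_one] at hy
  refine IsSemireal.one_add_ne_zero (R := IsLocalRing.ResidueField B) (s := y * y)
    (IsSumSq.mul_self _) ?_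
  linear_combination hy

open Polynomial in
/-- If some valuation of `K` has a finite residue field with `q` elements in which the integer `c`
is nonzero, then `X ^ q - X - c` has no simple root in the residue field of a henselian valuation
of `K`. -/
theorem IsHenselianValuationRing.derivative_eq_zero_of_finite {K : Type*} [Field K]
    {A : ValuationSubring K} (hA : IsHenselianValuationRing A) (B : ValuationSubring K)
    [Finite (IsLocalRing.ResidueField B)] {c : ℤ} (hc : (c : IsLocalRing.ResidueField B) ≠ 0)
    {t : IsLocalRing.ResidueField A}
    (ht : t ^ Nat.card (IsLocalRing.ResidueField B) - t - c = 0) :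
    (Nat.card (IsLocalRing.ResidueField B) : IsLocalRing.ResidueField A) *
      t ^ (Nat.card (IsLocalRing.ResidueField B) - 1) - 1 = 0 := by
  by_contra h
  have := Fintype.ofFinite (IsLocalRing.ResidueField B)
  have hq : 1 < Nat.card (IsLocalRing.ResidueField B) := Finite.one_lt_card
  have hm : (X ^ Nat.card (IsLocalRing.ResidueField B) - X - C c : ℤ[X]).Monic := by
    rw [sub_sub]
    refine monic_X_pow_sub ((degree_X_add_C c).trans_lt ?_)
    exact_mod_cast hq
  obtain ⟨y, hy⟩ := hA.exists_residue_root B hm (t := t) (by simpa using ht)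
    (by simpa [derivative_X_pow] using h)
  -- Since y^q = y on a field with q elements, the polynomial is constantly -c there.
  simp only [map_sub, map_pow, aeval_X, eq_intCast, map_intCast,
    Nat.card_eq_fintype_card, FiniteField.pow_card, sub_self, zero_sub, neg_eq_zero] at hy
  exact hc hy

/-- A henselian valuation with residue field of positive characteristic has the same residue
characteristic as any valuation with finite residue field. -/
theorem IsHenselianValuationRing.residue_char_eq {K : Type*} [Field K]
    {A : ValuationSubring K} (hA : IsHenselianValuationRing A) (B : ValuationSubring K)
    [Finite (IsLocalRing.ResidueField B)] {l p : ℕ} (hl : l.Prime) (hp : p.Prime)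
    [CharP (IsLocalRing.ResidueField A) l] [CharP (IsLocalRing.ResidueField B) p] : l = p := by
  by_contra hne
  have hc : ((l : ℤ) : IsLocalRing.ResidueField B) ≠ 0 := by
    rw [Int.cast_natCast, Ne, CharP.cast_eq_zero_iff (IsLocalRing.ResidueField B) p,
      Nat.prime_dvd_prime_iff_eq hp hl]
    exact fun h => hne h.symm
  have hq : 1 < Nat.card (IsLocalRing.ResidueField B) := Finite.one_lt_card
  -- With c = l, which vanishes in characteristic l, 0 is a root with derivative -1.
  have h := hA.derivative_eq_zero_of_finite B hc (t := 0) (by simp; omega)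
  rw [zero_pow (by omega)] at h
  simp at h

/-- In characteristic zero, `X ^ q - X - 1` has only simple roots. -/
theorem natCast_mul_pow_sub_one_ne_zero {F : Type*} [Field F] [CharZero F] {q : ℕ} (hq : 1 < q)
    {t : F} (ht : t ^ q - t - 1 = 0) : (q : F) * t ^ (q - 1) - 1 ≠ 0 := by
  obtain ⟨m, rfl⟩ : ∃ m, q = m + 1 := ⟨q - 1, by omega⟩
  rw [Nat.add_sub_cancel]
  intro h
  -- A multiple root has t^(m+1) = t + 1 and (m+1)t^m = 1, so t = (m+1)(t+1). Eliminating t leaves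
  -- an identity of integers.
  have h1 : -(m : F) * t = (m + 1 : ℕ) := by
    rw [pow_succ] at ht
    push_cast at h ⊢
    linear_combination (m + 1 : F) * ht - t * h
  have h2 : ((m + 1 : ℕ) : F) ^ (m + 1) = (-(m : F)) ^ m := by
    calc ((m + 1 : ℕ) : F) ^ (m + 1) = (m + 1 : ℕ) * (-(m : F) * t) ^ m := by rw [h1]; ring
      _ = (-(m : F)) ^ m * ((m + 1 : ℕ) * t ^ m) := by ring
      _ = (-(m : F)) ^ m := by rw [sub_eq_zero.mp h, mul_one]
  have h3 : ((m + 1 : ℕ) : ℤ) ^ (m + 1) = (-(m : ℤ)) ^ m := by exact_mod_cast h2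
  -- By `h3`, m + 1 divides a power of -m, to which it is coprime; so it is a unit, contradicting m
  -- ≥ 1.
  have hcop : IsCoprime ((m + 1 : ℕ) : ℤ) ((-(m : ℤ)) ^ m) :=
    IsCoprime.pow_right ⟨1, 1, by push_cast; ring⟩
  have hunit := hcop.isUnit_of_dvd' dvd_rfl (h3 ▸ dvd_pow_self _ m.succ_ne_zero)
  rw [Int.isUnit_iff] at hunit
  omega

open Polynomial in
/-- A henselian field with algebraically closed residue field has no valuation with
finite residue field. -/
theorem IsHenselianValuationRing.not_finite_of_isAlgClosed {K : Type*} [Field K]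
    {A : ValuationSubring K} (hA : IsHenselianValuationRing A)
    [IsAlgClosed (IsLocalRing.ResidueField A)] (B : ValuationSubring K) :
    ¬ Finite (IsLocalRing.ResidueField B) := by
  intro hB
  obtain ⟨p, hpB⟩ := CharP.exists (IsLocalRing.ResidueField B)
  have hp : p.Prime :=
    (CharP.char_is_prime_or_zero (IsLocalRing.ResidueField B) p).resolve_right
      (CharP.char_ne_zero_of_finite (IsLocalRing.ResidueField B) p)
  have hq : 1 < Nat.card (IsLocalRing.ResidueField B) := Finite.one_lt_card
  obtain ⟨t, ht⟩ : ∃ t : IsLocalRing.ResidueField A,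
      t ^ Nat.card (IsLocalRing.ResidueField B) - t - 1 = 0 := by
    have hdeg : (X + C 1 : (IsLocalRing.ResidueField A)[X]).degree <
        (Nat.card (IsLocalRing.ResidueField B) : ℕ) := by
      rw [degree_X_add_C]; exact_mod_cast hq
    obtain ⟨t, ht⟩ := IsAlgClosed.exists_root
      (X ^ Nat.card (IsLocalRing.ResidueField B) - (X + C 1) : (IsLocalRing.ResidueField A)[X])
      (by rw [degree_sub_eq_left_of_degree_lt (by rwa [degree_X_pow]), degree_X_pow]
          exact_mod_cast (by omega))
    exact ⟨t, by simpa [sub_sub] using ht⟩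
  have h := hA.derivative_eq_zero_of_finite B (c := 1) (by simp) (t := t) (by simpa using ht)
  obtain ⟨l, hl⟩ := CharP.exists (IsLocalRing.ResidueField A)
  rcases CharP.char_is_prime_or_zero (IsLocalRing.ResidueField A) l with hlp | rfl
  · obtain rfl := hA.residue_char_eq B hlp hp
    -- Equal characteristics make q vanish in the residue field of `A`, so the derivative is -1.
    have hdvd : l ∣ Nat.card (IsLocalRing.ResidueField B) := by
      rw [← CharP.cast_eq_zero_iff (IsLocalRing.ResidueField B) l]
      have := Fintype.ofFinite (IsLocalRing.ResidueField B)
      rw [Nat.card_eq_fintype_card, FiniteField.cast_card_eq_zero]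
    rw [(CharP.cast_eq_zero_iff (IsLocalRing.ResidueField A) l _).mpr hdvd] at h
    simp at h
  · have := CharP.charP_to_charZero (IsLocalRing.ResidueField A)
    exact natCast_mul_pow_sub_one_ne_zero hq ht h

theorem mainTheorem11 (K : Type*) [Field K] [Infinite K] :
    ¬ (IsACVFLike K ∧ ∃ p : ℕ, IsPCFLike p K) ∧
    ¬ (IsACVFLike K ∧ IsRCVFLike K) ∧
    ¬ ((∃ p : ℕ, IsPCFLike p K) ∧ IsRCVFLike K) ∧
    ∀ p q : ℕ, IsPCFLike p K → IsPCFLike q K → p = q := by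
  refine ⟨?_, ?_, ?_, ?_⟩
  · rintro ⟨⟨A, hA, _⟩, p, -, B, -, hB, -⟩
    exact hA.not_finite_of_isAlgClosed B hB
  · rintro ⟨⟨A, hA, _⟩, B, -, hB⟩
    exact hA.not_isRealClosed_of_isAlgClosed B hB
  · rintro ⟨⟨p, hp, A, hA, -, _⟩, B, -, hB⟩
    exact hA.not_isRealClosed_of_charP p hp B hB
  · rintro p q ⟨hp, A, hA, -, _⟩ ⟨hq, B, -, _, _⟩
    exact hA.residue_char_eq B hp hq
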